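/- Let $N,n\in\mathbb{N}$, let $\mathbf{a}=(a_1,\dots,a_N)$ be a vector of positive integers and let $p\in(1,\infty)$. For a multi-index $\alpha\in\mathbb{Z}_{\ge 0}^N$ put $\langle\alpha,\mathbf{a}^{-1}\rangle=\sum_{j=1}^N\alpha_j/a_j$, let $m$ be the number of $\alpha$ with $\langle\alpha,\mathbf{a}^{-1}\rangle=1$, and for $u\colon\Omega\subset\mathbb{R}^N\to\mathbb{R}^n$ let $\nabla_{\mathbf{a}}u=(\partial^\alpha u)_{\langle\alpha,\mathbf{a}^{-1}\rangle=1}$, with values in $\mathbb{R}^{n\times m}$, which carries the Euclidean norm $|\cdot|$. Let $W^{\mathbf{a},p}(\Omega;\mathbb{R}^n)$ be the space of $u\in L^p(\Omega;\mathbb{R}^n)$ whose distributional derivatives $\partial^\alpha u$ with $\langle\alpha,\mathbf{a}^{-1}\rangle\le 1$ lie in $L^p$, normed by $\sum_{\langle\alpha,\mathbf{a}^{-1}\rangle\le 1}\|\partial^\alpha u\|_{L^p}$; let $W^{\mathbf{a},p}_0(\Omega;\mathbb{R}^n)$ be the closure of $C_c^\infty(\Omega;\mathbb{R}^n)$ in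 it, and for $g\in W^{\mathbf{a},p}(\mathbb{R}^N;\mathbb{R}^n)$ let $W^{\mathbf{a},p}_g(\Omega)=\{g+\phi:\phi\in W^{\mathbf{a},p}_0(\Omega;\mathbb{R}^n)\}$. Let $F\colon\mathbb{R}^{n\times m}\to[0,\infty)$ be a continuous function such that: (i) $F$ is $L^p$ coercive: there are a non-empty bounded open set $\Omega\subset\mathbb{R}^N$ and $g\in W^{\mathbf{a},p}(\mathbb{R}^N;\mathbb{R}^n)$ such that $\int_\Omega F(\nabla_{\mathbf{a}}u_j)\,dx\to\infty$ for every sequence $u_j\in W^{\mathbf{a},p}_g(\Omega)$ with $\|\nabla_{\mathbf{a}}u_j\|_{L^p(\Omega)}\to\infty$ (in particular, it suffices that this holds for all bounded open Lipschitz sets $\Omega$ and all $g$); (ii) there is $C\in\mathbb{R}$ with $F(X)\le C(|X|^p+1)$ for all $X\in\mathbb{R}^{n\times m}$; (iii) there is $D\in\mathbb{R}$ with $|F(X)-F(W)|\le D\,(1+|X|^{p-1}+|W|^{p-1})\,|X-W|$ for all $X,W\in\mathbb{R}^{n\times m}$. Then the $\mathbf{a}$-quasiconvex envelope $$\mathcal{Q}F(V)=\inf\left\{\frac{1}{|Q|}\int_Q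 F(V+\nabla_{\mathbf{a}}\phi(x))\,dx:\ \phi\in C_c^\infty(Q;\mathbb{R}^n)\right\},\qquad Q=(-1,1)^N,$$ is real-valued and continuous on $\mathbb{R}^{n\times m}$. -/

import Mathlib

open MeasureTheory Filter Topology
open scoped ContDiff ENNReal

noncomputable section

namespace MixedSmoothness

variable {N : ℕ}

/-- The pairing `⟨α, a⁻¹⟩ = ∑ j, α_j / a_j` of a multi-index with the vector of reciprocals of `a`. -/
def weight (a : Fin N → ℕ+) (α : Fin N → ℕ) : ℝ :=
  ∑ j, (α j : ℝ) / (a j : ℕ)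

/-- The multi-indices `α` with `⟨α, a⁻¹⟩ = 1`; their number is `m`. -/
abbrev TopIndex (a : Fin N → ℕ+) : Type :=
  {α : Fin N → ℕ // weight a α = 1}

theorem TopIndex.le {a : Fin N → ℕ+} (α : TopIndex a) (j : Fin N) : α.1 j ≤ (a j : ℕ) := by
  have hpos : (0 : ℝ) < ((a j : ℕ) : ℝ) := by exact_mod_cast (a j).pos
  have h1 : (α.1 j : ℝ) / (a j : ℕ) ≤ weight a α.1 :=
    Finset.single_le_sum (f := fun j => (α.1 j : ℝ) / (a j : ℕ))
      (fun i _ => by positivity) (Finset.mem_univ j)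
  rw [α.2, div_le_one hpos] at h1
  exact_mod_cast h1

instance TopIndex.finite (a : Fin N → ℕ+) : Finite (TopIndex a) :=
  Finite.of_injective
    (fun (α : TopIndex a) (j : Fin N) => (⟨α.1 j, Nat.lt_succ_of_le (α.le j)⟩ : Fin ((a j : ℕ) + 1)))
    (fun _ _ h => Subtype.ext (funext fun j => congrArg Fin.val (congrFun h j)))

instance TopIndex.fintype (a : Fin N → ℕ+) : Fintype (TopIndex a) :=
  Fintype.ofFinite _

/-- The space `ℝ^{n × m}` with its Euclidean norm. -/
abbrev GradSpace (n : ℕ) (a : Fin N → ℕ+) : Type :=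
  EuclideanSpace ℝ (Fin n × TopIndex a)

/-- The first order partial derivative `∂_i f`. -/
def partialD {G : Type*} [NormedAddCommGroup G] [NormedSpace ℝ G] (i : Fin N)
    (f : EuclideanSpace ℝ (Fin N) → G) : EuclideanSpace ℝ (Fin N) → G :=
  fun x => fderiv ℝ f x (EuclideanSpace.single i 1)

/-- The partial derivative `∂^α f = ∂_1^{α_1} ⋯ ∂_N^{α_N} f`. -/
def multiD {G : Type*} [NormedAddCommGroup G] [NormedSpace ℝ G] (α : Fin N → ℕ)
    (f : EuclideanSpace ℝ (Fin N) → G) : EuclideanSpace ℝ (Fin N) → G :=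
  (List.finRange N).foldr (fun i g => (partialD i)^[α i] g) f

/-- `φ ∈ C_c^∞(Ω; G)`. -/
def IsTest {G : Type*} [NormedAddCommGroup G] [NormedSpace ℝ G]
    (Ω : Set (EuclideanSpace ℝ (Fin N))) (φ : EuclideanSpace ℝ (Fin N) → G) : Prop :=
  ContDiff ℝ ∞ φ ∧ HasCompactSupport φ ∧ tsupport φ ⊆ Ω

/-- The (classical) `a`-gradient `∇_a φ = (∂^α φ)_{⟨α, a⁻¹⟩ = 1}` of a smooth map; its `i`-th row
consists of the derivatives of the `i`-th component. -/
def aGrad {n : ℕ} (a : Fin N → ℕ+)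
    (φ : EuclideanSpace ℝ (Fin N) → EuclideanSpace ℝ (Fin n)) :
    EuclideanSpace ℝ (Fin N) → GradSpace n a :=
  fun x => WithLp.toLp 2 fun k => multiD k.2.1 φ x k.1

/-- The (interior of the) cube `[-1, 1]^N`. -/
def cube (N : ℕ) : Set (EuclideanSpace ℝ (Fin N)) :=
  {x | ∀ i, x i ∈ Set.Ioo (-1 : ℝ) 1}

/-- The `a`-quasiconvex envelope
`𝒬F(V) = inf {⨍_Q F(V + ∇_a φ) dx : φ ∈ C_c^∞(Q; ℝⁿ)}`, with values in the extended reals. -/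
def qcEnvelope {n : ℕ} (a : Fin N → ℕ+) (F : GradSpace n a → ℝ) (V : GradSpace n a) : EReal :=
  ⨅ φ : {φ : EuclideanSpace ℝ (Fin N) → EuclideanSpace ℝ (Fin n) // IsTest (cube N) φ},
    ((⨍ x in cube N, F (V + aGrad a φ.1 x) : ℝ) : EReal)

/-- `v` is the distributional derivative `∂^α u` on the open set `Ω`. -/
def HasWeakDeriv {n : ℕ} (α : Fin N → ℕ) (Ω : Set (EuclideanSpace ℝ (Fin N)))
    (u v : EuclideanSpace ℝ (Fin N) → EuclideanSpace ℝ (Fin n)) : Prop :=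
  LocallyIntegrableOn u Ω ∧ LocallyIntegrableOn v Ω ∧
    ∀ ψ : EuclideanSpace ℝ (Fin N) → ℝ, IsTest Ω ψ →
      ∫ x in Ω, multiD α ψ x • u x = (-1 : ℝ) ^ (∑ j, α j) • ∫ x in Ω, ψ x • v x

/-- `U` is (a representative of) the weak `a`-gradient `∇_a u` on `Ω`. -/
def HasWeakGrad {n : ℕ} (a : Fin N → ℕ+) (Ω : Set (EuclideanSpace ℝ (Fin N)))
    (u : EuclideanSpace ℝ (Fin N) → EuclideanSpace ℝ (Fin n))
    (U : EuclideanSpace ℝ (Fin N) → GradSpace n a) : Prop :=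
  ∀ α : TopIndex a, HasWeakDeriv α.1 Ω u fun x => WithLp.toLp 2 fun i => U x (i, α)

/-- `u ∈ W^{a,p}(Ω; ℝⁿ)`: `u ∈ L^p(Ω)` and all distributional derivatives `∂^α u` with
`⟨α, a⁻¹⟩ ≤ 1` lie in `L^p(Ω)`. -/
def MemW {n : ℕ} (a : Fin N → ℕ+) (p : ℝ) (Ω : Set (EuclideanSpace ℝ (Fin N)))
    (u : EuclideanSpace ℝ (Fin N) → EuclideanSpace ℝ (Fin n)) : Prop :=
  MemLp u (ENNReal.ofReal p) (volume.restrict Ω) ∧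
    ∀ α : Fin N → ℕ, weight a α ≤ 1 →
      ∃ v, MemLp v (ENNReal.ofReal p) (volume.restrict Ω) ∧ HasWeakDeriv α Ω u v

/-- `u ∈ W^{a,p}_0(Ω; ℝⁿ)`, the completion of `C_c^∞(Ω; ℝⁿ)` in the norm
`∑_{⟨α, a⁻¹⟩ ≤ 1} ‖∂^α u‖_{L^p(Ω)}`, realised as a space of functions on `Ω`: the function `u` lies
in `W^{a,p}(Ω; ℝⁿ)` and is the limit in this norm of a sequence of test functions. -/
def MemW0 {n : ℕ} (a : Fin N → ℕ+) (p : ℝ) (Ω : Set (EuclideanSpace ℝ (Fin N)))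
    (u : EuclideanSpace ℝ (Fin N) → EuclideanSpace ℝ (Fin n)) : Prop :=
  MemW a p Ω u ∧
    ∃ φ : ℕ → EuclideanSpace ℝ (Fin N) → EuclideanSpace ℝ (Fin n),
      (∀ k, IsTest Ω (φ k)) ∧
      ∀ α : Fin N → ℕ, weight a α ≤ 1 → ∃ v, HasWeakDeriv α Ω u v ∧
        Tendsto (fun k => eLpNorm (multiD α (φ k) - v) (ENNReal.ofReal p) (volume.restrict Ω))
          atTop (𝓝 0)

/-- The Dirichlet class `W^{a,p}_g(Ω) = {g + φ : φ ∈ W^{a,p}_0(Ω)}`. -/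
def dirichletClass {n : ℕ} (a : Fin N → ℕ+) (p : ℝ) (Ω : Set (EuclideanSpace ℝ (Fin N)))
    (g : EuclideanSpace ℝ (Fin N) → EuclideanSpace ℝ (Fin n)) :
    Set (EuclideanSpace ℝ (Fin N) → EuclideanSpace ℝ (Fin n)) :=
  {u | ∃ φ, MemW0 a p Ω φ ∧ u = g + φ}

/-- The functional `I(u, Ω) = ∫_Ω F(∇_a u) dx` is `L^q` coercive on `W^{a,p}_g(Ω)`: for every
sequence `u_j` in the Dirichlet class with `‖∇_a u_j‖_{L^q(Ω)} → ∞` one has `I(u_j, Ω) → ∞`.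
Here `U j` is a representative of the weak `a`-gradient of `u j`. -/
def CoerciveOn {n : ℕ} (a : Fin N → ℕ+) (p q : ℝ) (F : GradSpace n a → ℝ)
    (Ω : Set (EuclideanSpace ℝ (Fin N)))
    (g : EuclideanSpace ℝ (Fin N) → EuclideanSpace ℝ (Fin n)) : Prop :=
  ∀ (u : ℕ → EuclideanSpace ℝ (Fin N) → EuclideanSpace ℝ (Fin n))
    (U : ℕ → EuclideanSpace ℝ (Fin N) → GradSpace n a),
    (∀ j, u j ∈ dirichletClass a p Ω g) → (∀ j, HasWeakGrad a Ω (u j) (U j)) →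
    Tendsto (fun j => eLpNorm (U j) (ENNReal.ofReal q) (volume.restrict Ω)) atTop (𝓝 (⊤ : ℝ≥0∞)) →
    Tendsto (fun j => ∫ x in Ω, F (U j x)) atTop atTop

/-- The integrand `F` is `L^p` coercive: its functional is `L^p` coercive on the Dirichlet class of
some datum `g ∈ W^{a,p}(ℝ^N; ℝⁿ)` on some non-empty bounded open set. Requiring this for one
pair `(Ω, g)` only makes it the weakest of the usual forms of the condition. -/
def LpCoercive {n : ℕ} (a : Fin N → ℕ+) (p : ℝ) (F : GradSpace n a → ℝ) : Prop :=
  ∃ (Ω : Set (EuclideanSpace ℝ (Fin N)))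
    (g : EuclideanSpace ℝ (Fin N) → EuclideanSpace ℝ (Fin n)),
    IsOpen Ω ∧ Bornology.IsBounded Ω ∧ Ω.Nonempty ∧ MemW a p Set.univ g ∧ CoerciveOn a p p F Ω g

end MixedSmoothness

end

open MixedSmoothness

noncomputable section

namespace MixedSmoothness

variable {N n : ℕ} {G : Type*} [NormedAddCommGroup G] [NormedSpace ℝ G]

/-! ### Iterated partial derivatives of smooth functions -/

/-! For fixed `φ`, condition (iii) makes `V ↦ ⨍_Q F(V + ∇_a φ)` Lipschitz on balls, with a constant
controlled by `∫ |∇_a φ|^p` (`cubeEnergy_le_add`). An infimum of equi-Lipschitz functions is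
Lipschitz, so it suffices to bound the energy of near-minimisers uniformly for `V` in a ball.
Coercivity provides this (`LpCoercive.exists_bound`), although it is assumed for one domain and one
datum only.

The transfer uses anisotropic scaling. Put `σ = ∑ 1/a_i`. The map `x ↦ r φ((r^{-1/a_i}(x_i -
x₀_i))_i)` has the `a`-gradient of `φ` evaluated at the rescaled point, so all integrals of that
gradient are multiplied by `r^σ`. If the bound failed, there would be test functions on the cube
with `∫ F(V + ∇_a φ) ≤ M` and arbitrarily large energy. Such a function can be shrunk into a tiny
cell of `Ω` so that its energy becomes exactly `k`. Replacing `V` by the gradient `U` of the datum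
costs, by a Young-type inequality with parameter `k`, at most `|Φ|^p / k + k^{p-1}(1 + K + |U|)^p`
up to a constant. The first term integrates to at most `1`; so does the second, by absolute
continuity, once the cell is small (`exists_rescaled_test`). Letting `k → ∞` keeps the functional
bounded while the gradient norm blows up, against coercivity. -/

theorem iterate_partialD_induction {P : (EuclideanSpace ℝ (Fin N) → G) → Prop}
    (hP : ∀ i f, P f → P (partialD i f)) (i : Fin N) (k : ℕ) {f : EuclideanSpace ℝ (Fin N) → G}
    (hf : P f) : P ((partialD i)^[k] f) := by
  induction k generalizing f with
  | zero => exact hf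
  | succ k ih => exact ih (hP i f hf)

theorem foldr_partialD_induction {P : (EuclideanSpace ℝ (Fin N) → G) → Prop}
    (hP : ∀ i f, P f → P (partialD i f)) (α : Fin N → ℕ) (l : List (Fin N))
    {f : EuclideanSpace ℝ (Fin N) → G} (hf : P f) :
    P (l.foldr (fun i g => (partialD i)^[α i] g) f) := by
  induction l with
  | nil => exact hf
  | cons i l ih => exact iterate_partialD_induction hP i (α i) ih

theorem multiD_induction {P : (EuclideanSpace ℝ (Fin N) → G) → Prop}
    (hP : ∀ i f, P f → P (partialD i f)) (α : Fin N → ℕ)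
    {f : EuclideanSpace ℝ (Fin N) → G} (hf : P f) : P (multiD α f) :=
  foldr_partialD_induction hP α _ hf

theorem contDiff_partialD (i : Fin N) (f : EuclideanSpace ℝ (Fin N) → G) (hf : ContDiff ℝ ∞ f) :
    ContDiff ℝ ∞ (partialD i f) :=
  (hf.fderiv_right (m := ∞) (by simp)).clm_apply contDiff_const

theorem IsTest.partialD {Ω : Set (EuclideanSpace ℝ (Fin N))} (i : Fin N)
    (f : EuclideanSpace ℝ (Fin N) → G) (hf : IsTest Ω f) : IsTest Ω (partialD i f) :=
  ⟨contDiff_partialD i f hf.1, hf.2.1.fderiv_apply ℝ _,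
    (tsupport_fderiv_apply_subset ℝ _).trans hf.2.2⟩

theorem IsTest.multiD {Ω : Set (EuclideanSpace ℝ (Fin N))} (α : Fin N → ℕ)
    {f : EuclideanSpace ℝ (Fin N) → G} (hf : IsTest Ω f) : IsTest Ω (multiD α f) :=
  multiD_induction (IsTest.partialD (Ω := Ω)) α hf

theorem IsTest.continuous {Ω : Set (EuclideanSpace ℝ (Fin N))}
    {f : EuclideanSpace ℝ (Fin N) → G} (hf : IsTest Ω f) : Continuous f := hf.1.continuous

theorem IsTest.mono {Ω Ω' : Set (EuclideanSpace ℝ (Fin N))} (h : Ω ⊆ Ω')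
    {f : EuclideanSpace ℝ (Fin N) → G} (hf : IsTest Ω f) : IsTest Ω' f :=
  ⟨hf.1, hf.2.1, hf.2.2.trans h⟩

theorem IsTest.eq_zero {Ω : Set (EuclideanSpace ℝ (Fin N))}
    {f : EuclideanSpace ℝ (Fin N) → G} (hf : IsTest Ω f) {x} (hx : x ∉ Ω) : f x = 0 :=
  image_eq_zero_of_notMem_tsupport fun h => hx (hf.2.2 h)

theorem isTest_zero (Ω : Set (EuclideanSpace ℝ (Fin N))) :
    IsTest Ω (0 : EuclideanSpace ℝ (Fin N) → G) :=
  ⟨contDiff_const, HasCompactSupport.zero, by simp⟩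

theorem partialD_comm (i j : Fin N) {f : EuclideanSpace ℝ (Fin N) → G} (hf : ContDiff ℝ ∞ f) :
    partialD i (partialD j f) = partialD j (partialD i f) := by
  have hd : Differentiable ℝ (fderiv ℝ f) :=
    (hf.fderiv_right (m := ∞) (by simp)).differentiable (by simp)
  funext x
  have hs : IsSymmSndFDerivAt ℝ f x := hf.contDiffAt.isSymmSndFDerivAt 
    (by simpa using ENat.LEInfty.out)
  have key (k : Fin N) (v : EuclideanSpace ℝ (Fin N)) :
      fderiv ℝ (partialD k f) x v = fderiv ℝ (fderiv ℝ f) x v (EuclideanSpace.single k 1) := by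
    unfold partialD
    rw [fderiv_clm_apply (hd x) (differentiableAt_const _)]
    simp
  change fderiv ℝ (partialD j f) x _ = fderiv ℝ (partialD i f) x _
  rw [key, key]
  exact hs _ _

theorem partialD_iterate_comm (i j : Fin N) (k : ℕ) {f : EuclideanSpace ℝ (Fin N) → G}
    (hf : ContDiff ℝ ∞ f) :
    partialD i ((partialD j)^[k] f) = (partialD j)^[k] (partialD i f) := by
  induction k generalizing f with
  | zero => rfl
  | succ k ih =>
    rw [Function.iterate_succ_apply, Function.iterate_succ_apply, ih (contDiff_partialD j f hf),
      partialD_comm i j hf]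

theorem partialD_foldr_comm (i : Fin N) (α : Fin N → ℕ) (l : List (Fin N))
    {f : EuclideanSpace ℝ (Fin N) → G} (hf : ContDiff ℝ ∞ f) :
    partialD i (l.foldr (fun j g => (partialD j)^[α j] g) f) =
      l.foldr (fun j g => (partialD j)^[α j] g) (partialD i f) := by
  induction l with
  | nil => rfl
  | cons j l ih =>
    rw [List.foldr_cons, List.foldr_cons, ← ih,
      partialD_iterate_comm i j _ (foldr_partialD_induction contDiff_partialD α l hf)]

/-- Integration by parts moves the outermost operator first and hence reverses the order of the
derivatives; this commutation restores it. -/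
theorem iterate_partialD_foldr_comm (i : Fin N) (k : ℕ) (α : Fin N → ℕ) (l : List (Fin N))
    {f : EuclideanSpace ℝ (Fin N) → G} (hf : ContDiff ℝ ∞ f) :
    (partialD i)^[k] (l.foldr (fun j g => (partialD j)^[α j] g) f) =
      l.foldr (fun j g => (partialD j)^[α j] g) ((partialD i)^[k] f) := by
  induction k generalizing f with
  | zero => rfl
  | succ k ih =>
    rw [Function.iterate_succ_apply, Function.iterate_succ_apply, partialD_foldr_comm i α l hf,
      ih (contDiff_partialD i f hf)]

/-! ### Integration by parts and weak derivatives of test functions -/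

theorem IsTest.integrable_smul {Ω : Set (EuclideanSpace ℝ (Fin N))}
    {ψ : EuclideanSpace ℝ (Fin N) → ℝ} {u : EuclideanSpace ℝ (Fin N) → G}
    (hψ : IsTest Ω ψ) (hu : Continuous u) : Integrable (fun x => ψ x • u x) :=
  (hψ.continuous.smul hu).integrable_of_hasCompactSupport hψ.2.1.smul_right

theorem integral_partialD_smul {Ω : Set (EuclideanSpace ℝ (Fin N))} (i : Fin N)
    {ψ : EuclideanSpace ℝ (Fin N) → ℝ} {u : EuclideanSpace ℝ (Fin N) → G}
    (hψ : IsTest Ω ψ) (hu : ContDiff ℝ ∞ u) :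
    ∫ x, partialD i ψ x • u x = - ∫ x, ψ x • partialD i u x := by
  have h := integral_smul_fderiv_eq_neg_fderiv_smul_of_integrable (μ := volume) (f := ψ) (g := u)
    (v := EuclideanSpace.single i 1)
    ((hψ.partialD i ψ).integrable_smul hu.continuous)
    (hψ.integrable_smul (contDiff_partialD i u hu).continuous)
    (hψ.integrable_smul hu.continuous)
    (fun x _ => (hψ.1.differentiable (by simp)) x) (fun x _ => (hu.differentiable (by simp)) x)
  exact (neg_eq_iff_eq_neg.mpr h).symm

theorem integral_iterate_partialD_smul {Ω : Set (EuclideanSpace ℝ (Fin N))} (i : Fin N) (k : ℕ)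
    {ψ : EuclideanSpace ℝ (Fin N) → ℝ} {u : EuclideanSpace ℝ (Fin N) → G}
    (hψ : IsTest Ω ψ) (hu : ContDiff ℝ ∞ u) :
    ∫ x, (partialD i)^[k] ψ x • u x = (-1 : ℝ) ^ k • ∫ x, ψ x • (partialD i)^[k] u x := by
  induction k generalizing ψ with
  | zero => simp
  | succ k ih =>
    rw [Function.iterate_succ_apply, ih (hψ.partialD i ψ),
      integral_partialD_smul i hψ (iterate_partialD_induction contDiff_partialD i k hu),
      Function.iterate_succ_apply', pow_succ, mul_smul]
    simp

theorem integral_foldr_partialD_smul {Ω : Set (EuclideanSpace ℝ (Fin N))} (α : Fin N → ℕ)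
    (l : List (Fin N)) {ψ : EuclideanSpace ℝ (Fin N) → ℝ} {u : EuclideanSpace ℝ (Fin N) → G}
    (hψ : IsTest Ω ψ) (hu : ContDiff ℝ ∞ u) :
    ∫ x, l.foldr (fun i g => (partialD i)^[α i] g) ψ x • u x =
      (-1 : ℝ) ^ (l.map α).sum •
        ∫ x, ψ x • l.foldr (fun i g => (partialD i)^[α i] g) u x := by
  induction l generalizing u with
  | nil => simp
  | cons i l ih =>
    rw [List.foldr_cons, integral_iterate_partialD_smul i (α i)
      (foldr_partialD_induction (IsTest.partialD (Ω := Ω)) α l hψ) hu,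
      ih (iterate_partialD_induction contDiff_partialD i _ hu),
      ← iterate_partialD_foldr_comm i _ α l hu, smul_smul, ← pow_add]
    simp

theorem integral_multiD_smul {Ω : Set (EuclideanSpace ℝ (Fin N))} (α : Fin N → ℕ)
    {ψ : EuclideanSpace ℝ (Fin N) → ℝ} {u : EuclideanSpace ℝ (Fin N) → G}
    (hψ : IsTest Ω ψ) (hu : ContDiff ℝ ∞ u) :
    ∫ x, multiD α ψ x • u x = (-1 : ℝ) ^ (∑ j, α j) • ∫ x, ψ x • multiD α u x := by
  have h := integral_foldr_partialD_smul α (List.finRange N) hψ hu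
  rwa [← List.ofFn_eq_map, List.sum_ofFn] at h

theorem IsTest.setIntegral_smul {Ω : Set (EuclideanSpace ℝ (Fin N))}
    {ψ : EuclideanSpace ℝ (Fin N) → ℝ} (u : EuclideanSpace ℝ (Fin N) → G) (hψ : IsTest Ω ψ) :
    ∫ x in Ω, ψ x • u x = ∫ x, ψ x • u x :=
  setIntegral_eq_integral_of_forall_compl_eq_zero fun x hx => by rw [hψ.eq_zero hx, zero_smul]

theorem hasWeakDeriv_multiD {Ω : Set (EuclideanSpace ℝ (Fin N))} (α : Fin N → ℕ)
    {φ : EuclideanSpace ℝ (Fin N) → EuclideanSpace ℝ (Fin n)} (hφ : ContDiff ℝ ∞ φ) :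
    HasWeakDeriv α Ω φ (multiD α φ) := by
  refine ⟨hφ.continuous.locallyIntegrable.locallyIntegrableOn _,
    (multiD_induction contDiff_partialD α hφ).continuous.locallyIntegrable.locallyIntegrableOn _,
    fun ψ hψ => ?_⟩
  rw [(hψ.multiD α).setIntegral_smul, hψ.setIntegral_smul, integral_multiD_smul α hψ hφ]

theorem HasWeakDeriv.of_univ {Ω : Set (EuclideanSpace ℝ (Fin N))} {α : Fin N → ℕ}
    {u v : EuclideanSpace ℝ (Fin N) → EuclideanSpace ℝ (Fin n)}
    (h : HasWeakDeriv α Set.univ u v) : HasWeakDeriv α Ω u v := by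
  refine ⟨h.1.mono_set (Set.subset_univ _), h.2.1.mono_set (Set.subset_univ _), fun ψ hψ => ?_⟩
  have := h.2.2 ψ (hψ.mono (Set.subset_univ _))
  rw [setIntegral_univ, setIntegral_univ] at this
  rw [(hψ.multiD α).setIntegral_smul, hψ.setIntegral_smul, this]

theorem HasWeakDeriv.integrable_smul {α : Fin N → ℕ}
    {u v : EuclideanSpace ℝ (Fin N) → EuclideanSpace ℝ (Fin n)}
    (h : HasWeakDeriv α Set.univ u v) {Ω : Set (EuclideanSpace ℝ (Fin N))}
    {ψ : EuclideanSpace ℝ (Fin N) → ℝ} (hψ : IsTest Ω ψ) :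
    Integrable (fun x => ψ x • u x) ∧ Integrable (fun x => ψ x • v x) :=
  ⟨(locallyIntegrableOn_univ.1 h.1).integrable_smul_left_of_hasCompactSupport
      hψ.continuous hψ.2.1,
    (locallyIntegrableOn_univ.1 h.2.1).integrable_smul_left_of_hasCompactSupport
      hψ.continuous hψ.2.1⟩

theorem HasWeakDeriv.add {α : Fin N → ℕ}
    {u v u' v' : EuclideanSpace ℝ (Fin N) → EuclideanSpace ℝ (Fin n)}
    (h : HasWeakDeriv α Set.univ u v) (h' : HasWeakDeriv α Set.univ u' v') :
    HasWeakDeriv α Set.univ (u + u') (v + v') := by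
  refine ⟨h.1.add h'.1, h.2.1.add h'.2.1, fun ψ hψ => ?_⟩
  have e := h.2.2 ψ hψ
  have e' := h'.2.2 ψ hψ
  rw [setIntegral_univ, setIntegral_univ] at *
  simp only [Pi.add_apply, smul_add]
  rw [integral_add (h.integrable_smul (hψ.multiD α)).1 (h'.integrable_smul (hψ.multiD α)).1,
    integral_add (h.integrable_smul hψ).2 (h'.integrable_smul hψ).2, e, e', smul_add]

theorem IsTest.memLp {Ω : Set (EuclideanSpace ℝ (Fin N))} {p : ℝ≥0∞}
    {φ : EuclideanSpace ℝ (Fin N) → G} (hφ : IsTest Ω φ) :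
    MemLp φ p (volume.restrict Ω) :=
  (hφ.continuous.memLp_of_hasCompactSupport hφ.2.1).restrict Ω

theorem IsTest.memW0 {Ω : Set (EuclideanSpace ℝ (Fin N))} (a : Fin N → ℕ+) (p : ℝ)
    {φ : EuclideanSpace ℝ (Fin N) → EuclideanSpace ℝ (Fin n)} (hφ : IsTest Ω φ) :
    MemW0 a p Ω φ := by
  refine ⟨⟨hφ.memLp, fun α _ => ⟨_, (hφ.multiD α).memLp, hasWeakDeriv_multiD α hφ.1⟩⟩,
    fun _ => φ, fun _ => hφ, fun α _ => ⟨_, hasWeakDeriv_multiD α hφ.1, ?_⟩⟩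
  simp

/-! ### The `a`-gradient of a test function -/

theorem IsTest.continuous_aGrad {Ω : Set (EuclideanSpace ℝ (Fin N))} (a : Fin N → ℕ+)
    {φ : EuclideanSpace ℝ (Fin N) → EuclideanSpace ℝ (Fin n)} (hφ : IsTest Ω φ) :
    Continuous (aGrad a φ) := by
  refine (PiLp.continuous_toLp 2 _).comp (continuous_pi fun k => ?_)
  exact (EuclideanSpace.proj (𝕜 := ℝ) k.1).continuous.comp (hφ.multiD k.2.1).continuous

theorem IsTest.aGrad_eq_zero {Ω : Set (EuclideanSpace ℝ (Fin N))} (a : Fin N → ℕ+)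
    {φ : EuclideanSpace ℝ (Fin N) → EuclideanSpace ℝ (Fin n)} (hφ : IsTest Ω φ) {x}
    (hx : x ∉ tsupport φ) : aGrad a φ x = 0 := by
  -- `IsTest` does not ask its set to be open, so the support itself is allowed, which localises the
  -- derivatives to `tsupport φ`.
  have h : IsTest (tsupport φ) φ := ⟨hφ.1, hφ.2.1, subset_rfl⟩
  ext k
  simp [aGrad, (h.multiD k.2.1).eq_zero hx]

theorem IsTest.hasCompactSupport_aGrad {Ω : Set (EuclideanSpace ℝ (Fin N))} (a : Fin N → ℕ+)
    {φ : EuclideanSpace ℝ (Fin N) → EuclideanSpace ℝ (Fin n)} (hφ : IsTest Ω φ) :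
    HasCompactSupport (aGrad a φ) :=
  HasCompactSupport.intro hφ.2.1 fun _ hx => hφ.aGrad_eq_zero a hx

/-- A datum of class `W^{a,p}` on the whole space has a weak `a`-gradient in `L^p`, and adding a test
function adds its classical `a`-gradient. -/
theorem MemW.exists_weakGrad {a : Fin N → ℕ+} {p : ℝ}
    {g : EuclideanSpace ℝ (Fin N) → EuclideanSpace ℝ (Fin n)} (hg : MemW a p Set.univ g) :
    ∃ U : EuclideanSpace ℝ (Fin N) → GradSpace n a, MemLp U (ENNReal.ofReal p) volume ∧
      ∀ Ω φ, IsTest Ω φ → HasWeakGrad a Ω (g + φ) (U + aGrad a φ) := by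
  have h (α : TopIndex a) := hg.2 α.1 α.2.le
  choose v hv hgv using h
  refine ⟨fun x => WithLp.toLp 2 fun k => v k.2 x k.1, ?_, fun Ω φ hφ α => ?_⟩
  · rw [← Measure.restrict_univ (μ := volume)]
    refine MemLp.of_eval_piLp fun k => ?_
    exact (hv k.2).eval_piLp k.1
  · exact ((hgv α).add (hasWeakDeriv_multiD α.1 hφ.1)).of_univ

/-! ### Anisotropic rescaling -/

/-- The diagonal map `x ↦ (c_i x_i)_i`. -/
def dilation (c : Fin N → ℝ) : EuclideanSpace ℝ (Fin N) →L[ℝ] EuclideanSpace ℝ (Fin N) :=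
  (Matrix.toLpLin 2 2 (Matrix.diagonal c)).toContinuousLinearMap

theorem dilation_apply (c : Fin N → ℝ) (x : EuclideanSpace ℝ (Fin N)) (i : Fin N) :
    dilation c x i = c i * x i := by
  simp [dilation, Matrix.toLpLin_apply, Matrix.mulVec_diagonal]

theorem dilation_single (c : Fin N → ℝ) (i : Fin N) :
    dilation c (EuclideanSpace.single i 1) = c i • EuclideanSpace.single i 1 := by
  ext j
  rw [dilation_apply]
  by_cases h : j = i <;> simp [h]

/-- The prefactor `b` is arbitrary so that it can absorb the chain-rule factor `c i` when
derivatives are iterated. -/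
theorem partialD_comp_dilation (c : Fin N → ℝ) (x₀ : EuclideanSpace ℝ (Fin N)) (i : Fin N)
    (b : ℝ) {f : EuclideanSpace ℝ (Fin N) → G} (hf : ContDiff ℝ ∞ f) :
    partialD i (fun x => b • f (dilation c (x - x₀))) =
      fun x => (b * c i) • partialD i f (dilation c (x - x₀)) := by
  funext x
  have hT : HasFDerivAt (fun x => dilation c (x - x₀)) (dilation c) x := by
    have h := (dilation c).hasFDerivAt.comp x ((hasFDerivAt_id x).sub_const x₀)
    rwa [ContinuousLinearMap.comp_id] at h
  have hf' := (hf.differentiable (by simp) (dilation c (x - x₀))).hasFDerivAt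
  have h := ((hf'.comp x hT).const_smul b).fderiv
  unfold partialD
  rw [show (fun x => b • f (dilation c (x - x₀))) = b • (f ∘ fun x => dilation c (x - x₀)) from rfl,
    h]
  simp [dilation_single, smul_smul]

theorem iterate_partialD_comp_dilation (c : Fin N → ℝ) (x₀ : EuclideanSpace ℝ (Fin N)) (i : Fin N)
    (k : ℕ) (b : ℝ) {f : EuclideanSpace ℝ (Fin N) → G} (hf : ContDiff ℝ ∞ f) :
    (partialD i)^[k] (fun x => b • f (dilation c (x - x₀))) =
      fun x => (b * c i ^ k) • (partialD i)^[k] f (dilation c (x - x₀)) := by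
  induction k generalizing b f with
  | zero => simp
  | succ k ih =>
    rw [Function.iterate_succ_apply, partialD_comp_dilation c x₀ i b hf,
      ih _ (contDiff_partialD i f hf), Function.iterate_succ_apply]
    funext x
    ring_nf

theorem foldr_partialD_comp_dilation (c : Fin N → ℝ) (x₀ : EuclideanSpace ℝ (Fin N))
    (α : Fin N → ℕ) (l : List (Fin N)) (b : ℝ) {f : EuclideanSpace ℝ (Fin N) → G}
    (hf : ContDiff ℝ ∞ f) :
    l.foldr (fun i g => (partialD i)^[α i] g) (fun x => b • f (dilation c (x - x₀))) =
      fun x => (b * (l.map fun i => c i ^ α i).prod) •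
        l.foldr (fun i g => (partialD i)^[α i] g) f (dilation c (x - x₀)) := by
  induction l with
  | nil => simp
  | cons i l ih =>
    rw [List.foldr_cons, List.foldr_cons, ih, iterate_partialD_comp_dilation c x₀ i _ _
      (foldr_partialD_induction contDiff_partialD α l hf), List.map_cons, List.prod_cons]
    funext x
    ring_nf

theorem multiD_comp_dilation (c : Fin N → ℝ) (x₀ : EuclideanSpace ℝ (Fin N))
    (α : Fin N → ℕ) (b : ℝ) {f : EuclideanSpace ℝ (Fin N) → G} (hf : ContDiff ℝ ∞ f) :
    multiD α (fun x => b • f (dilation c (x - x₀))) =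
      fun x => (b * ∏ i, c i ^ α i) • multiD α f (dilation c (x - x₀)) := by
  have h := foldr_partialD_comp_dilation c x₀ α (List.finRange N) b hf
  rwa [← List.ofFn_eq_map, List.prod_ofFn] at h

theorem map_dilation_sub {c : Fin N → ℝ} (hc : ∀ i, 0 < c i) (x₀ : EuclideanSpace ℝ (Fin N)) :
    Measure.map (fun x => dilation c (x - x₀)) volume = ENNReal.ofReal (∏ i, c i)⁻¹ • volume := by
  have hdet : LinearMap.det (Matrix.toLpLin 2 2 (Matrix.diagonal c)) = ∏ i, c i := by
    rw [LinearMap.det_toLpLin, Matrix.det_diagonal]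
  have hpos : 0 < ∏ i, c i := Finset.prod_pos fun i _ => hc i
  have h := Measure.map_linearMap_addHaar_eq_smul_addHaar (volume : Measure (EuclideanSpace ℝ (Fin N)))
    (f := Matrix.toLpLin 2 2 (Matrix.diagonal c)) (by rw [hdet]; exact hpos.ne')
  rw [hdet, abs_of_pos (inv_pos.2 hpos)] at h
  rw [show (fun x => dilation c (x - x₀)) = (dilation c) ∘ (fun x => x - x₀) from rfl,
    ← Measure.map_map (dilation c).measurable (by fun_prop),
    (measurePreserving_sub_right volume x₀).map_eq]
  exact h

/-- The anisotropic rescaling `x ↦ (r^{-1/a_i} (x_i - x₀_i))_i`. -/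
def rescale (a : Fin N → ℕ+) (r : ℝ) (x₀ x : EuclideanSpace ℝ (Fin N)) :
    EuclideanSpace ℝ (Fin N) :=
  dilation (fun i => r ^ (-(1 / ((a i : ℕ) : ℝ)))) (x - x₀)

/-- Used twice: indices of weight one give the factor `r⁻¹` in the `a`-gradient, and `α = 1` gives
the Jacobian `r^{-σ}`. -/
theorem prod_rpow_pow (a : Fin N → ℕ+) {r : ℝ} (hr : 0 < r) (α : Fin N → ℕ) :
    ∏ i, (r ^ (-(1 / ((a i : ℕ) : ℝ)))) ^ α i = r ^ (-weight a α) := by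
  unfold weight
  rw [← Finset.sum_neg_distrib, Real.rpow_sum_of_pos hr]
  refine Finset.prod_congr rfl fun i _ => ?_
  rw [← Real.rpow_mul_natCast hr.le]
  ring_nf

theorem map_rescale (a : Fin N → ℕ+) {r : ℝ} (hr : 0 < r) (x₀ : EuclideanSpace ℝ (Fin N)) :
    Measure.map (rescale a r x₀) volume = ENNReal.ofReal (r ^ weight a 1) • volume := by
  have h := prod_rpow_pow a hr 1
  simp only [Pi.one_apply, pow_one] at h
  unfold rescale
  rw [map_dilation_sub (fun i => Real.rpow_pos_of_pos hr _), h, Real.rpow_neg hr.le, inv_inv]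

theorem continuous_rescale (a : Fin N → ℕ+) (r : ℝ) (x₀ : EuclideanSpace ℝ (Fin N)) :
    Continuous (rescale a r x₀) :=
  (dilation _).continuous.comp (continuous_id.sub continuous_const)

theorem measurableEmbedding_rescale (a : Fin N → ℕ+) {r : ℝ} (hr : 0 < r)
    (x₀ : EuclideanSpace ℝ (Fin N)) : MeasurableEmbedding (rescale a r x₀) := by
  refine (continuous_rescale a r x₀).measurableEmbedding fun x y h => ?_
  ext i
  have hi := congrArg (fun z : EuclideanSpace ℝ (Fin N) => z i) h
  simp only [rescale, dilation_apply, PiLp.sub_apply] at hi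
  linarith [mul_left_cancel₀ (Real.rpow_pos_of_pos hr _).ne' hi]

/-- Every entry has weight exactly one, so the chain rule produces `r⁻¹`, which the amplitude `r`
cancels. -/
theorem aGrad_rescale (a : Fin N → ℕ+) {r : ℝ} (hr : 0 < r) (x₀ : EuclideanSpace ℝ (Fin N))
    {φ : EuclideanSpace ℝ (Fin N) → EuclideanSpace ℝ (Fin n)} (hφ : ContDiff ℝ ∞ φ) :
    aGrad a (fun x => r • φ (rescale a r x₀ x)) = fun x => aGrad a φ (rescale a r x₀ x) := by
  funext x
  ext k
  simp only [aGrad, rescale]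
  rw [multiD_comp_dilation _ x₀ _ r hφ, prod_rpow_pow a hr, k.2.2, Real.rpow_neg_one,
    mul_inv_cancel₀ hr.ne']
  simp only [one_smul]

theorem isTest_rescale (a : Fin N → ℕ+) {r : ℝ} (hr : 0 < r) (x₀ : EuclideanSpace ℝ (Fin N))
    {Ω Q : Set (EuclideanSpace ℝ (Fin N))} (hQ : rescale a r x₀ ⁻¹' Q ⊆ Ω)
    {φ : EuclideanSpace ℝ (Fin N) → G} (hφ : IsTest Q φ) :
    IsTest Ω (fun x => r • φ (rescale a r x₀ x)) := by
  refine ⟨?_, ?_, ?_⟩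
  · exact contDiff_const.smul
      (hφ.1.comp ((dilation _).contDiff.comp (contDiff_id.sub contDiff_const)))
  -- The compact set is the image of the support under the inverse rescaling.
  · refine HasCompactSupport.intro (hφ.2.1.image
      (f := fun y => dilation (fun i => r ^ (1 / ((a i : ℕ) : ℝ))) y + x₀)
      ((dilation _).continuous.add continuous_const)) fun x hx => ?_
    rw [image_eq_zero_of_notMem_tsupport (f := φ), smul_zero]
    refine fun h => hx ⟨_, h, ?_⟩
    ext i
    simp only [rescale, dilation_apply, PiLp.add_apply, PiLp.sub_apply]
    rw [← mul_assoc, ← Real.rpow_add hr]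
    simp
  · refine (closure_minimal (fun x hx => ?_) ((isClosed_tsupport φ).preimage
      (continuous_rescale a r x₀))).trans ((Set.preimage_mono hφ.2.2).trans hQ)
    refine subset_tsupport φ fun h => hx ?_
    simp [h]

theorem eventually_preimage_rescale_subset (a : Fin N → ℕ+) {x₀ : EuclideanSpace ℝ (Fin N)}
    {Ω : Set (EuclideanSpace ℝ (Fin N))} (hΩ : Ω ∈ 𝓝 x₀) :
    ∀ᶠ r in 𝓝[>] (0 : ℝ), rescale a r x₀ ⁻¹' cube N ⊆ Ω := by
  -- The rescaled cube is a box with half-sides `r^{1/a_i}`, so the sup metric on `Fin N → ℝ` is the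
  -- convenient one.
  have hpre : (fun y : Fin N → ℝ => (WithLp.toLp 2 y : EuclideanSpace ℝ (Fin N))) ⁻¹' Ω ∈
      𝓝 (WithLp.ofLp x₀) := (PiLp.continuous_toLp 2 _).continuousAt.preimage_mem_nhds hΩ
  obtain ⟨δ, hδ, hsub⟩ := Metric.mem_nhds_iff.1 hpre
  have hev : ∀ᶠ r in 𝓝[>] (0 : ℝ), ∀ i, r ^ (1 / ((a i : ℕ) : ℝ)) < δ := by
    refine eventually_all.2 fun i => ?_
    have hpos : (0 : ℝ) < 1 / ((a i : ℕ) : ℝ) := by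
      have := (a i).pos
      positivity
    have ht : Tendsto (fun r : ℝ => r ^ (1 / ((a i : ℕ) : ℝ))) (𝓝[>] 0) (𝓝 0) := by
      have := (Real.continuousAt_rpow_const 0 (1 / ((a i : ℕ) : ℝ)) (Or.inr hpos.le)).tendsto
      rw [Real.zero_rpow hpos.ne'] at this
      exact this.mono_left nhdsWithin_le_nhds
    exact ht.eventually (gt_mem_nhds hδ)
  filter_upwards [hev, self_mem_nhdsWithin] with r hr hr0 x hx
  have hmem : WithLp.ofLp x ∈ Metric.ball (WithLp.ofLp x₀) δ := by
    rw [Metric.mem_ball, dist_pi_lt_iff hδ]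
    intro i
    have hi := hx i
    simp only [rescale, dilation_apply, PiLp.sub_apply] at hi
    have hr0' : (0 : ℝ) < r := hr0
    have habs : |r ^ (-(1 / ((a i : ℕ) : ℝ))) * (x i - x₀ i)| < 1 := abs_lt.2 hi
    rw [abs_mul, abs_of_pos (Real.rpow_pos_of_pos hr0' _), Real.rpow_neg hr0'.le,
      inv_mul_lt_iff₀ (Real.rpow_pos_of_pos hr0' _), mul_one] at habs
    rw [Real.dist_eq]
    exact habs.trans (hr i)
  exact hsub hmem

theorem isOpen_cube (N : ℕ) : IsOpen (cube N) := by
  have : cube N = ⋂ i, (fun x : EuclideanSpace ℝ (Fin N) => x i) ⁻¹' Set.Ioo (-1) 1 := by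
    ext x; simp [cube]
  rw [this]
  exact isOpen_iInter_of_finite fun i => isOpen_Ioo.preimage (by fun_prop)

theorem volume_cube (N : ℕ) : volume (cube N) = 2 ^ N := by
  have h := (EuclideanSpace.volume_preserving_symm_measurableEquiv_toLp (Fin N)).measure_preimage_equiv
    (Set.pi Set.univ fun _ : Fin N => Set.Ioo (-1 : ℝ) 1)
  have e : (MeasurableEquiv.toLp 2 (Fin N → ℝ)).symm ⁻¹'
      (Set.pi Set.univ fun _ : Fin N => Set.Ioo (-1 : ℝ) 1) = cube N := by
    ext x; simp [cube]
  rw [← e, h, Real.volume_pi_Ioo]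
  norm_num

theorem weight_one_pos [NeZero N] (a : Fin N → ℕ+) : 0 < weight a 1 := by
  unfold weight
  refine Finset.sum_pos (fun i _ => ?_) ⟨0, Finset.mem_univ _⟩
  have := (a i).pos
  simp only [Pi.one_apply]
  positivity

/-! ### Growth estimates for the integrand -/

/-- A weighted Young inequality: `t + h ≤ 2 max(t, k h)`, and when `t` is the larger one, `h ≤ t /
k`. -/
theorem add_rpow_mul_le {p t h k : ℝ} (hp : 1 < p) (ht : 0 ≤ t) (hh : 1 ≤ h) (hk : 1 ≤ k) :
    (t + h) ^ (p - 1) * h ≤ 2 ^ p * (t ^ p / k + k ^ (p - 1) * h ^ p) := by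
  have hp1 : 0 ≤ p - 1 := by linarith
  have hk0 : 0 < k := by linarith
  have hh0 : 0 < h := by linarith
  have h2 : (2 : ℝ) ^ (p - 1) ≤ 2 ^ p := Real.rpow_le_rpow_of_exponent_le (by norm_num) (by linarith)
  have split {x : ℝ} (hx : 0 < x) : x ^ p = x ^ (p - 1) * x := by
    rw [← Real.rpow_add_one hx.ne', sub_add_cancel]
  rcases le_total (k * h) t with hc | hc
  · have hht : h ≤ t := by nlinarith
    have ht0 : 0 < t := by linarith
    have h1 : (t + h) ^ (p - 1) ≤ 2 ^ p * t ^ (p - 1) := by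
      calc (t + h) ^ (p - 1) ≤ (2 * t) ^ (p - 1) :=
            Real.rpow_le_rpow (by linarith) (by linarith) hp1
        _ = 2 ^ (p - 1) * t ^ (p - 1) := Real.mul_rpow (by norm_num) ht
        _ ≤ 2 ^ p * t ^ (p - 1) := by gcongr
    calc (t + h) ^ (p - 1) * h ≤ (2 ^ p * t ^ (p - 1)) * (t / k) := by
          gcongr
          rwa [le_div_iff₀ hk0, mul_comm]
      _ = 2 ^ p * (t ^ p / k) := by rw [split ht0]; ring
      _ ≤ _ := by
        gcongr
        exact le_add_of_nonneg_right (by positivity)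
  · have h1 : (t + h) ^ (p - 1) ≤ 2 ^ p * (k ^ (p - 1) * h ^ (p - 1)) := by
      calc (t + h) ^ (p - 1) ≤ (2 * (k * h)) ^ (p - 1) :=
            Real.rpow_le_rpow (by linarith) (by nlinarith) hp1
        _ = 2 ^ (p - 1) * (k ^ (p - 1) * h ^ (p - 1)) := by
            rw [Real.mul_rpow (by norm_num) (by positivity), Real.mul_rpow hk0.le hh0.le]
        _ ≤ 2 ^ p * (k ^ (p - 1) * h ^ (p - 1)) := by gcongr
    calc (t + h) ^ (p - 1) * h ≤ (2 ^ p * (k ^ (p - 1) * h ^ (p - 1))) * h := by gcongr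
      _ = 2 ^ p * (k ^ (p - 1) * h ^ p) := by rw [split hh0]; ring
      _ ≤ _ := by
        gcongr
        exact le_add_of_nonneg_left (by positivity)

/-- Under a `p`-Lipschitz condition, shifting the argument by `U` instead of `V` costs little of the
energy of `Φ` when `k` is large. -/
theorem le_add_of_lipschitz {E : Type*} [NormedAddCommGroup E] {F : E → ℝ} {p D K k : ℝ}
    (hp : 1 < p) (hD : 0 ≤ D) (hk : 1 ≤ k)
    (hF : ∀ X W, |F X - F W| ≤ D * (1 + ‖X‖ ^ (p - 1) + ‖W‖ ^ (p - 1)) * ‖X - W‖)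
    {U V : E} (hV : ‖V‖ ≤ K) (Φ : E) :
    F (U + Φ) ≤ F (V + Φ) +
      3 * D * 2 ^ p * (‖Φ‖ ^ p / k + k ^ (p - 1) * (1 + K + ‖U‖) ^ p) := by
  have hK : 0 ≤ K := (norm_nonneg V).trans hV
  have hp1 : 0 ≤ p - 1 := by linarith
  have hh : 1 ≤ 1 + K + ‖U‖ := by linarith [norm_nonneg U]
  -- This `h` dominates `‖U‖`, `‖V‖` and `‖U - V‖`; the summand `1` gives `h ≥ 1`, so each of the
  -- three terms in the Lipschitz factor is at most `(‖Φ‖ + h)^(p-1)`.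
  set h := 1 + K + ‖U‖ with hdef
  have hU' : ‖U + Φ‖ ≤ ‖Φ‖ + h := by linarith [norm_add_le U Φ]
  have hV' : ‖V + Φ‖ ≤ ‖Φ‖ + h := by linarith [norm_add_le V Φ, norm_nonneg U]
  have hUV : ‖U + Φ - (V + Φ)‖ ≤ h := by
    rw [add_sub_add_right_eq_sub]
    linarith [norm_sub_le U V]
  have h1 : (1 : ℝ) ≤ (‖Φ‖ + h) ^ (p - 1) :=
    Real.one_le_rpow (by linarith [norm_nonneg Φ]) hp1
  have h2 := Real.rpow_le_rpow (norm_nonneg _) hU' hp1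
  have h3 := Real.rpow_le_rpow (norm_nonneg _) hV' hp1
  have h4 := add_rpow_mul_le hp (norm_nonneg Φ) hh hk
  have h5 : D * (1 + ‖U + Φ‖ ^ (p - 1) + ‖V + Φ‖ ^ (p - 1)) * ‖U + Φ - (V + Φ)‖ ≤
      D * (3 * (‖Φ‖ + h) ^ (p - 1)) * h := by
    gcongr
    linarith
  have h6 : D * (3 * (‖Φ‖ + h) ^ (p - 1)) * h ≤
      3 * D * (2 ^ p * (‖Φ‖ ^ p / k + k ^ (p - 1) * h ^ p)) := by
    calc _ = 3 * D * ((‖Φ‖ + h) ^ (p - 1) * h) := by ring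
      _ ≤ _ := by gcongr
  linarith [le_abs_self (F (U + Φ) - F (V + Φ)), hF (U + Φ) (V + Φ)]

/-! ### Integrals of rescaled functions -/

theorem integral_comp_rescale (a : Fin N → ℕ+) {r : ℝ} (hr : 0 < r)
    (x₀ : EuclideanSpace ℝ (Fin N)) (f : EuclideanSpace ℝ (Fin N) → ℝ) :
    ∫ x, f (rescale a r x₀ x) = r ^ weight a 1 * ∫ x, f x := by
  rw [← (measurableEmbedding_rescale a hr x₀).integral_map, map_rescale a hr, integral_smul_measure,
    ENNReal.toReal_ofReal (Real.rpow_nonneg hr.le _), smul_eq_mul]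

theorem setIntegral_comp_rescale (a : Fin N → ℕ+) {r : ℝ} (hr : 0 < r)
    (x₀ : EuclideanSpace ℝ (Fin N)) (s : Set (EuclideanSpace ℝ (Fin N)))
    (f : EuclideanSpace ℝ (Fin N) → ℝ) :
    ∫ x in rescale a r x₀ ⁻¹' s, f (rescale a r x₀ x) = r ^ weight a 1 * ∫ x in s, f x := by
  rw [← (measurableEmbedding_rescale a hr x₀).setIntegral_map, map_rescale a hr,
    Measure.restrict_smul, integral_smul_measure,
    ENNReal.toReal_ofReal (Real.rpow_nonneg hr.le _), smul_eq_mul]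

theorem tendsto_volume_preimage_rescale [NeZero N] (a : Fin N → ℕ+)
    (x₀ : EuclideanSpace ℝ (Fin N)) :
    Tendsto (fun r => volume (rescale a r x₀ ⁻¹' cube N)) (𝓝[>] 0) (𝓝 0) := by
  have hs := weight_one_pos a
  have ht : Tendsto (fun r : ℝ => r ^ weight a 1) (𝓝[>] 0) (𝓝 0) := by
    have h := (Real.continuousAt_rpow_const 0 (weight a 1) (Or.inr hs.le)).tendsto
    rw [Real.zero_rpow hs.ne'] at h
    exact h.mono_left nhdsWithin_le_nhds
  have h2 := ENNReal.Tendsto.mul_const (b := volume (cube N)) (ENNReal.tendsto_ofReal ht)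
    (Or.inr (by rw [volume_cube]; finiteness))
  rw [ENNReal.ofReal_zero, zero_mul] at h2
  refine h2.congr' ?_
  filter_upwards [self_mem_nhdsWithin] with r hr
  rw [← Measure.map_apply (continuous_rescale a r x₀).measurable (isOpen_cube N).measurableSet,
    map_rescale a hr]
  simp

/-! ### Transfer of coercivity to the unit cube -/

/-- A test function on the cube of large energy can be rescaled into `Ω` to one of energy exactly
`k`, at a cost for the functional that does not depend on `k`. -/
theorem exists_rescaled_test [NeZero N] (a : Fin N → ℕ+) {p D K M : ℝ} (hp : 1 < p) (hD : 0 ≤ D)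
    {F : GradSpace n a → ℝ} (hF0 : ∀ X, 0 ≤ F X) (hFc : Continuous F)
    (hF : ∀ X W, |F X - F W| ≤ D * (1 + ‖X‖ ^ (p - 1) + ‖W‖ ^ (p - 1)) * ‖X - W‖)
    {Ω : Set (EuclideanSpace ℝ (Fin N))} (hΩ : IsOpen Ω) (hb : Bornology.IsBounded Ω)
    (hne : Ω.Nonempty) {U : EuclideanSpace ℝ (Fin N) → GradSpace n a}
    (hU : IntegrableOn (fun x => (1 + K + ‖U x‖) ^ p) Ω)
    (hFU : IntegrableOn (fun x => F (U x)) Ω) {k : ℝ} (hk : 1 ≤ k) :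
    ∃ B, ∀ (V : GradSpace n a) (φ : EuclideanSpace ℝ (Fin N) → EuclideanSpace ℝ (Fin n)),
      ‖V‖ ≤ K → IsTest (cube N) φ → ∫ x in cube N, F (V + aGrad a φ x) ≤ M →
      B < ∫ x, ‖aGrad a φ x‖ ^ p →
      ∃ ψ : EuclideanSpace ℝ (Fin N) → EuclideanSpace ℝ (Fin n), IsTest Ω ψ ∧
        ∫ x, ‖aGrad a ψ x‖ ^ p = k ∧
        ∫ x in Ω, F (U x + aGrad a ψ x) ≤ (∫ x in Ω, F (U x)) + M + 3 * D * 2 ^ p * 2 := by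
  obtain ⟨x₀, hx₀⟩ := hne
  have hs := weight_one_pos a
  have hk0 : 0 < k := by linarith
  have hp0 : 0 < p := by linarith
  have hsub := eventually_preimage_rescale_subset a (hΩ.mem_nhds hx₀)
  -- Absolute continuity of the integral; the threshold is chosen to cancel the factor `k^(p-1)` of
  -- `le_add_of_lipschitz`.
  have hsmall : ∀ᶠ r in 𝓝[>] (0 : ℝ),
      ∫ x in rescale a r x₀ ⁻¹' cube N, (1 + K + ‖U x‖) ^ p ∂(volume.restrict Ω) <
        (k ^ (p - 1))⁻¹ := by
    refine (hU.tendsto_setIntegral_nhds_zero ?_).eventually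
      (gt_mem_nhds (inv_pos.2 (Real.rpow_pos_of_pos hk0 _)))
    exact tendsto_of_tendsto_of_tendsto_of_le_of_le tendsto_const_nhds
      (tendsto_volume_preimage_rescale a x₀) (fun _ => zero_le)
      (fun _ => Measure.restrict_apply_le _ _)
  have hone : ∀ᶠ r in 𝓝[>] (0 : ℝ), r < 1 :=
    (gt_mem_nhds zero_lt_one).filter_mono nhdsWithin_le_nhds
  obtain ⟨ρ, hρ, hρI⟩ := (mem_nhdsGT_iff_exists_Ioo_subset).1
    ((hsub.and hsmall).and hone)
  have hρ0 : (0 : ℝ) < ρ := hρ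
  -- Energy above this value forces the radius solving `r^σ T = k` to be smaller than `ρ`.
  refine ⟨k / ρ ^ weight a 1, fun V φ hV hφ hM hB => ?_⟩
  have hT : 0 < ∫ x, ‖aGrad a φ x‖ ^ p := lt_of_le_of_lt (by positivity) hB
  set T := ∫ x, ‖aGrad a φ x‖ ^ p with hTdef
  obtain ⟨r, hr0, hrρ, hrT⟩ : ∃ r : ℝ, 0 < r ∧ r < ρ ∧ r ^ weight a 1 * T = k := by
    refine ⟨(k / T) ^ (1 / weight a 1), by positivity, ?_, ?_⟩
    · rw [← Real.rpow_lt_rpow_iff (by positivity) hρ0.le hs, ← Real.rpow_mul (by positivity),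
        one_div_mul_cancel hs.ne', Real.rpow_one, div_lt_comm₀ hT (by positivity)]
      exact hB
    · rw [← Real.rpow_mul (by positivity), one_div_mul_cancel hs.ne', Real.rpow_one,
        div_mul_cancel₀ _ hT.ne']
  obtain ⟨⟨hQ, hH⟩, hr1⟩ := hρI ⟨hr0, hrρ⟩
  set Q := rescale a r x₀ ⁻¹' cube N with hQdef
  have hQm : MeasurableSet Q := ((isOpen_cube N).preimage (continuous_rescale a r x₀)).measurableSet
  have hψ := isTest_rescale a hr0 x₀ hQ hφ
  have hgrad := aGrad_rescale a hr0 x₀ hφ.1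
  refine ⟨_, hψ, ?_, ?_⟩
  · rw [hgrad, integral_comp_rescale a hr0 x₀ (fun y => ‖aGrad a φ y‖ ^ p), hrT]
  have hc : Continuous fun x => aGrad a φ (rescale a r x₀ x) := hgrad ▸ hψ.continuous_aGrad a
  set Φ := fun x => aGrad a φ (rescale a r x₀ x) with hΦ
  have hcomp : IsCompact (closure Q) := (hb.subset hQ).isCompact_closure
  have hloc {f : EuclideanSpace ℝ (Fin N) → ℝ} (hf : Continuous f) : IntegrableOn f Q :=
    (hf.locallyIntegrable.integrableOn_isCompact hcomp).mono_set subset_closure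
  have i1 : IntegrableOn (fun x => F (V + Φ x)) Q := hloc (hFc.comp (continuous_const.add hc))
  have i2 : IntegrableOn (fun x => ‖Φ x‖ ^ p) Q :=
    hloc (hc.norm.rpow_const fun _ => Or.inr hp0.le)
  have i3 : IntegrableOn (fun x => (1 + K + ‖U x‖) ^ p) Q := hU.mono_set hQ
  set L := 3 * D * 2 ^ p with hL
  have hL0 : 0 ≤ L := by positivity
  have i5 : IntegrableOn
      (fun x => L * (‖Φ x‖ ^ p / k + k ^ (p - 1) * (1 + K + ‖U x‖) ^ p)) Q :=
    ((i2.div_const k).add (i3.const_mul (k ^ (p - 1)))).const_mul L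
  have i4 : IntegrableOn
      (fun x => F (V + Φ x) + L * (‖Φ x‖ ^ p / k + k ^ (p - 1) * (1 + K + ‖U x‖) ^ p)) Q :=
    i1.add i5
  have e1 : ∫ x in Q, F (V + Φ x) ≤ M := by
    rw [setIntegral_comp_rescale a hr0 x₀ (cube N) (fun y => F (V + aGrad a φ y))]
    have h0 : 0 ≤ ∫ x in cube N, F (V + aGrad a φ x) := integral_nonneg fun _ => hF0 _
    exact (mul_le_of_le_one_left h0 (Real.rpow_le_one hr0.le hr1.le hs.le)).trans hM
  have e2 : ∫ x in Q, ‖Φ x‖ ^ p ≤ k := by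
    rw [setIntegral_comp_rescale a hr0 x₀ (cube N) (fun y => ‖aGrad a φ y‖ ^ p),
      setIntegral_eq_integral_of_forall_compl_eq_zero, hrT]
    intro x hx
    rw [hφ.aGrad_eq_zero a (fun h => hx (hφ.2.2 h)), norm_zero, Real.zero_rpow hp0.ne']
  have e3 : ∫ x in Q, (1 + K + ‖U x‖) ^ p ≤ (k ^ (p - 1))⁻¹ := by
    rw [Measure.restrict_restrict hQm, Set.inter_eq_left.2 hQ] at hH
    exact hH.le
  -- Each of the two error terms contributes at most `L`.
  have e4 : ∫ x in Q, (F (V + Φ x) + L * (‖Φ x‖ ^ p / k + k ^ (p - 1) * (1 + K + ‖U x‖) ^ p)) ≤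
      M + L * 2 := by
    rw [integral_add i1 i5,
      integral_const_mul, integral_add (i2.div_const k) (i3.const_mul (k ^ (p - 1))),
      integral_div, integral_const_mul]
    have f2 : (∫ x in Q, ‖Φ x‖ ^ p) / k ≤ 1 := (div_le_one hk0).2 e2
    have f3 : k ^ (p - 1) * ∫ x in Q, (1 + K + ‖U x‖) ^ p ≤ 1 := by
      rwa [← le_inv_mul_iff₀ (Real.rpow_pos_of_pos hk0 _), mul_one]
    have := mul_le_mul_of_nonneg_left (add_le_add f2 f3) hL0
    linarith
  have hind := (integrable_indicator_iff hQm).2 i4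
  have e5 : ∫ x in Ω, Q.indicator (fun x =>
        F (V + Φ x) + L * (‖Φ x‖ ^ p / k + k ^ (p - 1) * (1 + K + ‖U x‖) ^ p)) x ≤ M + L * 2 := by
    rwa [setIntegral_indicator hQm, Set.inter_eq_right.2 hQ]
  rw [hgrad]
  calc ∫ x in Ω, F (U x + Φ x) ≤ ∫ x in Ω, (F (U x) + Q.indicator (fun x =>
        F (V + Φ x) + L * (‖Φ x‖ ^ p / k + k ^ (p - 1) * (1 + K + ‖U x‖) ^ p)) x) := by
        refine integral_mono_of_nonneg (ae_of_all _ fun _ => hF0 _)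
          (hFU.add hind.integrableOn) (ae_of_all _ fun x => ?_)
        -- On `Q` the shift estimate applies and `F (U x) ≥ 0` is spare; off `Q` the perturbation
        -- vanishes.
        by_cases hx : x ∈ Q
        · simp only [Set.indicator_of_mem hx]
          have := le_add_of_lipschitz hp hD hk hF (U := U x) hV (Φ x)
          linarith [hF0 (U x)]
        · have : Φ x = 0 := hφ.aGrad_eq_zero a (fun h => hx (hφ.2.2 h))
          simp [Set.indicator_of_notMem hx, this]
    _ = (∫ x in Ω, F (U x)) + ∫ x in Ω, Q.indicator (fun x =>
        F (V + Φ x) + L * (‖Φ x‖ ^ p / k + k ^ (p - 1) * (1 + K + ‖U x‖) ^ p)) x :=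
        integral_add hFU hind.integrableOn
    _ ≤ _ := by linarith

/-- Coercivity on a single Dirichlet class bounds the energy of test functions on the unit cube in
terms of the functional, uniformly for bounded affine parts. -/
theorem LpCoercive.exists_bound [NeZero N] {a : Fin N → ℕ+} {p C D : ℝ} (hp : 1 < p) (hD : 0 ≤ D)
    {F : GradSpace n a → ℝ} (hF0 : ∀ X, 0 ≤ F X) (hFc : Continuous F) (hco : LpCoercive a p F)
    (hC : ∀ X, F X ≤ C * (‖X‖ ^ p + 1))
    (hF : ∀ X W, |F X - F W| ≤ D * (1 + ‖X‖ ^ (p - 1) + ‖W‖ ^ (p - 1)) * ‖X - W‖)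
    {K : ℝ} (hK : 0 ≤ K) (M : ℝ) :
    ∃ B, ∀ (V : GradSpace n a) (φ : EuclideanSpace ℝ (Fin N) → EuclideanSpace ℝ (Fin n)),
      ‖V‖ ≤ K → IsTest (cube N) φ → ∫ x in cube N, F (V + aGrad a φ x) ≤ M →
      ∫ x, ‖aGrad a φ x‖ ^ p ≤ B := by
  obtain ⟨Ω, g, hΩ, hb, hne, hg, hcoer⟩ := hco
  obtain ⟨U, hU, hgrad⟩ := hg.exists_weakGrad
  have hp0 : 0 < p := by linarith
  have hpe0 : ENNReal.ofReal p ≠ 0 := by simpa using hp0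
  have hpt : (ENNReal.ofReal p).toReal = p := ENNReal.toReal_ofReal hp0.le
  have hfin : IsFiniteMeasure (volume.restrict Ω) := ⟨by simpa using hb.measure_lt_top⟩
  have hUΩ : MemLp U (ENNReal.ofReal p) (volume.restrict Ω) := hU.restrict Ω
  have hUp : IntegrableOn (fun x => ‖U x‖ ^ p) Ω := by
    have := hUΩ.integrable_norm_rpow hpe0 ENNReal.ofReal_ne_top
    rwa [hpt] at this
  have hUK : IntegrableOn (fun x => (1 + K + ‖U x‖) ^ p) Ω := by
    have := ((memLp_const (μ := volume.restrict Ω) (1 + K)).add hUΩ.norm).integrable_norm_rpow hpe0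
      ENNReal.ofReal_ne_top
    rw [hpt] at this
    refine this.congr (ae_of_all _ fun x => ?_)
    have : 0 ≤ 1 + K + ‖U x‖ := by positivity
    simp [abs_of_nonneg this]
  -- The growth bound is needed for this integrability.
  have hFU : IntegrableOn (fun x => F (U x)) Ω := by
    refine ((hUp.add (integrable_const 1)).const_mul C).mono'
      (hFc.comp_aestronglyMeasurable hUΩ.1) (ae_of_all _ fun x => ?_)
    rw [Real.norm_of_nonneg (hF0 _)]
    exact hC _
  by_contra! hcon
  have hstep (j : ℕ) : ∃ ψ : EuclideanSpace ℝ (Fin N) → EuclideanSpace ℝ (Fin n), IsTest Ω ψ ∧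
      ∫ x, ‖aGrad a ψ x‖ ^ p = (j : ℝ) + 1 ∧
      ∫ x in Ω, F (U x + aGrad a ψ x) ≤ (∫ x in Ω, F (U x)) + M + 3 * D * 2 ^ p * 2 := by
    -- Here `k = j + 1`, so that `k ≥ 1`. The matrix `V` may change with `j`, since only `‖V‖ ≤ K`
    -- matters.
    obtain ⟨B, hB⟩ := exists_rescaled_test a (M := M) hp hD hF0 hFc hF hΩ hb hne hUK hFU
      (k := (j : ℝ) + 1) (by linarith [Nat.cast_nonneg (α := ℝ) j])
    obtain ⟨V, φ, h1, h2, h3, h4⟩ := hcon B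
    exact hB V φ h1 h2 h3 h4
  choose ψ hψ hψk hψF using hstep
  have hnorm (j : ℕ) : eLpNorm (aGrad a (ψ j)) (ENNReal.ofReal p) (volume.restrict Ω) =
      ENNReal.ofReal (((j : ℝ) + 1) ^ p⁻¹) := by
    have hm : MemLp (aGrad a (ψ j)) (ENNReal.ofReal p) (volume.restrict Ω) :=
      (((hψ j).continuous_aGrad a).memLp_of_hasCompactSupport
        ((hψ j).hasCompactSupport_aGrad a)).restrict Ω
    rw [hm.eLpNorm_eq_integral_rpow_norm hpe0 ENNReal.ofReal_ne_top, hpt,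
      setIntegral_eq_integral_of_forall_compl_eq_zero, hψk]
    intro x hx
    rw [(hψ j).aGrad_eq_zero a (fun h => hx ((hψ j).2.2 h)), norm_zero, Real.zero_rpow hp0.ne']
  -- A lower bound for the norm of `U + aGrad a (ψ j)` by the triangle inequality; it diverges
  -- because the norm of `U` is finite.
  have htop : Tendsto (fun j : ℕ => ENNReal.ofReal (((j : ℝ) + 1) ^ p⁻¹) -
      eLpNorm U (ENNReal.ofReal p) (volume.restrict Ω)) atTop (𝓝 ⊤) := by
    have h1 : Tendsto (fun j : ℕ => ENNReal.ofReal (((j : ℝ) + 1) ^ p⁻¹)) atTop (𝓝 ⊤) :=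
      ENNReal.tendsto_ofReal_atTop.comp ((tendsto_rpow_atTop (inv_pos.2 hp0)).comp
        (tendsto_atTop_add_const_right _ _ tendsto_natCast_atTop_atTop))
    have h2 := ENNReal.Tendsto.sub h1
      (tendsto_const_nhds (x := eLpNorm U (ENNReal.ofReal p) (volume.restrict Ω)))
      (Or.inr hUΩ.eLpNorm_ne_top)
    rwa [ENNReal.top_sub hUΩ.eLpNorm_ne_top] at h2
  have hlim := hcoer (fun j => g + ψ j) (fun j => U + aGrad a (ψ j))
    (fun j => ⟨ψ j, (hψ j).memW0 a p, rfl⟩) (fun j => hgrad Ω (ψ j) (hψ j))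
    (tendsto_of_tendsto_of_tendsto_of_le_of_le htop tendsto_const_nhds (fun j => by
      simp only
      rw [tsub_le_iff_right, ← hnorm j]
      calc eLpNorm (aGrad a (ψ j)) (ENNReal.ofReal p) (volume.restrict Ω)
          = eLpNorm (U + aGrad a (ψ j) - U) (ENNReal.ofReal p) (volume.restrict Ω) := by
            rw [add_sub_cancel_left]
        _ ≤ _ := eLpNorm_sub_le (hUΩ.1.add ((hψ j).continuous_aGrad a).aestronglyMeasurable) hUΩ.1
            (by simpa using hp.le)) (fun _ => le_top))
  obtain ⟨j, hj⟩ := (hlim.eventually_gt_atTop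
    ((∫ x in Ω, F (U x)) + M + 3 * D * 2 ^ p * 2)).exists
  exact absurd (hψF j) (not_le.2 hj)

/-! ### The envelope -/

/-- The average `⨍_Q F(V + ∇_a φ)` over the unit cube. -/
def cubeEnergy (a : Fin N → ℕ+) (F : GradSpace n a → ℝ)
    (φ : EuclideanSpace ℝ (Fin N) → EuclideanSpace ℝ (Fin n)) (V : GradSpace n a) : ℝ :=
  ⨍ x in cube N, F (V + aGrad a φ x)

theorem cubeEnergy_eq (a : Fin N → ℕ+) (F : GradSpace n a → ℝ)
    (φ : EuclideanSpace ℝ (Fin N) → EuclideanSpace ℝ (Fin n)) (V : GradSpace n a) :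
    cubeEnergy a F φ V = (2 ^ N)⁻¹ * ∫ x in cube N, F (V + aGrad a φ x) := by
  rw [cubeEnergy, setAverage_eq, measureReal_def, volume_cube, smul_eq_mul]
  simp

theorem cubeEnergy_nonneg (a : Fin N → ℕ+) {F : GradSpace n a → ℝ} (hF0 : ∀ X, 0 ≤ F X)
    (φ : EuclideanSpace ℝ (Fin N) → EuclideanSpace ℝ (Fin n)) (V : GradSpace n a) :
    0 ≤ cubeEnergy a F φ V := by
  rw [cubeEnergy_eq]
  exact mul_nonneg (by positivity) (integral_nonneg fun _ => hF0 _)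

/-- The envelope as a real-valued function. -/
def realEnvelope (a : Fin N → ℕ+) (F : GradSpace n a → ℝ) (V : GradSpace n a) : ℝ :=
  ⨅ φ : {φ : EuclideanSpace ℝ (Fin N) → EuclideanSpace ℝ (Fin n) // IsTest (cube N) φ},
    cubeEnergy a F φ.1 V

theorem realEnvelope_le (a : Fin N → ℕ+) {F : GradSpace n a → ℝ} (hF0 : ∀ X, 0 ≤ F X)
    {φ : EuclideanSpace ℝ (Fin N) → EuclideanSpace ℝ (Fin n)} (hφ : IsTest (cube N) φ)
    (V : GradSpace n a) : realEnvelope a F V ≤ cubeEnergy a F φ V :=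
  ciInf_le (f := fun φ : {φ : EuclideanSpace ℝ (Fin N) → EuclideanSpace ℝ (Fin n) //
    IsTest (cube N) φ} => cubeEnergy a F φ.1 V)
    ⟨0, by rintro _ ⟨φ, rfl⟩; exact cubeEnergy_nonneg a hF0 _ _⟩ ⟨φ, hφ⟩

/-- Nonnegativity of `F` excludes `⊥` and the competitor `0` excludes `⊤`, so the extended infimum
is the real one. -/
theorem qcEnvelope_eq_realEnvelope (a : Fin N → ℕ+) {F : GradSpace n a → ℝ}
    (hF0 : ∀ X, 0 ≤ F X) (V : GradSpace n a) :
    qcEnvelope a F V = (realEnvelope a F V : EReal) := by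
  have : Nonempty {φ : EuclideanSpace ℝ (Fin N) → EuclideanSpace ℝ (Fin n) //
    IsTest (cube N) φ} := ⟨⟨0, isTest_zero _⟩⟩
  have hle (φ : {φ : EuclideanSpace ℝ (Fin N) → EuclideanSpace ℝ (Fin n) //
      IsTest (cube N) φ}) : qcEnvelope a F V ≤ (cubeEnergy a F φ.1 V : EReal) := iInf_le _ φ
  have hge : ((realEnvelope a F V : ℝ) : EReal) ≤ qcEnvelope a F V :=
    le_iInf fun φ => EReal.coe_le_coe_iff.2 (realEnvelope_le a hF0 φ.2 V)
  have hbot : qcEnvelope a F V ≠ ⊥ := fun h => by simp [h] at hge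
  have htop : qcEnvelope a F V ≠ ⊤ := fun h => by
    have := hle ⟨0, isTest_zero _⟩
    simp [h] at this
  refine le_antisymm ?_ hge
  rw [← EReal.coe_toReal htop hbot] at hle ⊢
  exact EReal.coe_le_coe_iff.2 (le_ciInf fun φ => EReal.coe_le_coe_iff.1 (hle φ))

theorem realEnvelope_le_self (a : Fin N → ℕ+) {F : GradSpace n a → ℝ} (hF0 : ∀ X, 0 ≤ F X)
    (V : GradSpace n a) : realEnvelope a F V ≤ F V := by
  have h0 := isTest_zero (N := N) (G := EuclideanSpace ℝ (Fin n))
  refine (realEnvelope_le a hF0 (h0 _) V).trans_eq ?_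
  have hz (x : EuclideanSpace ℝ (Fin N)) :
      aGrad a (0 : EuclideanSpace ℝ (Fin N) → EuclideanSpace ℝ (Fin n)) x = 0 :=
    (h0 Set.univ).aGrad_eq_zero a (by simp)
  rw [cubeEnergy_eq]
  simp only [hz, add_zero]
  rw [setIntegral_const, measureReal_def, volume_cube]
  simp

theorem isBounded_cube (N : ℕ) : Bornology.IsBounded (cube N) := by
  refine (Metric.isBounded_closedBall (x := 0) (r := √N)).subset fun x hx => ?_
  rw [mem_closedBall_zero_iff, EuclideanSpace.norm_eq]
  refine Real.sqrt_le_sqrt ?_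
  calc ∑ i, ‖x i‖ ^ 2 ≤ ∑ _i : Fin N, (1 : ℝ) := Finset.sum_le_sum fun i _ => by
        rw [Real.norm_eq_abs]
        exact pow_le_one₀ (abs_nonneg _) (abs_lt.2 (hx i)).le
    _ = N := by simp

theorem integrableOn_cube_of_continuous {f : EuclideanSpace ℝ (Fin N) → ℝ} (hf : Continuous f) :
    IntegrableOn f (cube N) :=
  (hf.locallyIntegrable.integrableOn_isCompact (isBounded_cube N).isCompact_closure).mono_set
    subset_closure

/-- For test functions of bounded energy, `V ↦ ⨍_Q F(V + ∇_a φ)` is Lipschitz on balls. -/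
theorem cubeEnergy_le_add (a : Fin N → ℕ+) {p D K B : ℝ} (hp : 1 < p) (hD : 0 ≤ D)
    {F : GradSpace n a → ℝ} (hFc : Continuous F)
    (hF : ∀ X W, |F X - F W| ≤ D * (1 + ‖X‖ ^ (p - 1) + ‖W‖ ^ (p - 1)) * ‖X - W‖)
    {φ : EuclideanSpace ℝ (Fin N) → EuclideanSpace ℝ (Fin n)} (hφ : IsTest (cube N) φ)
    (hB : ∫ x, ‖aGrad a φ x‖ ^ p ≤ B) {V W : GradSpace n a} (hV : ‖V‖ ≤ K) (hW : ‖W‖ ≤ K) :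
    cubeEnergy a F φ W ≤ cubeEnergy a F φ V +
      (2 ^ N)⁻¹ * (3 * D * 2 ^ p * (B + 2 ^ N * (1 + K) ^ p)) * ‖W - V‖ := by
  have hK : 0 ≤ K := (norm_nonneg V).trans hV
  have hp1 : 0 ≤ p - 1 := by linarith
  have hp0 : 0 < p := by linarith
  have hc := hφ.continuous_aGrad a
  have hpt (Φ : GradSpace n a) : F (W + Φ) ≤ F (V + Φ) +
      3 * D * 2 ^ p * ‖W - V‖ * (‖Φ‖ ^ p + (1 + K) ^ p) := by
    have hW' : ‖W + Φ‖ ≤ ‖Φ‖ + (1 + K) := by linarith [norm_add_le W Φ]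
    have hV' : ‖V + Φ‖ ≤ ‖Φ‖ + (1 + K) := by linarith [norm_add_le V Φ]
    have h1 : (1 : ℝ) ≤ (‖Φ‖ + (1 + K)) ^ (p - 1) :=
      Real.one_le_rpow (by linarith [norm_nonneg Φ]) hp1
    have h2 := Real.rpow_le_rpow (norm_nonneg _) hW' hp1
    have h3 := Real.rpow_le_rpow (norm_nonneg _) hV' hp1
    -- No smallness is needed here, so the parameter is `k = 1`; `h5` supplies the extra factor `1 +
    -- K ≥ 1` that this inequality expects.
    have h4 := add_rpow_mul_le hp (norm_nonneg Φ) (h := 1 + K) (by linarith) (le_refl (1 : ℝ))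
    rw [Real.one_rpow, div_one, one_mul] at h4
    have h5 := le_mul_of_one_le_right (zero_le_one.trans h1) (show 1 ≤ 1 + K by linarith)
    have h6 := hF (W + Φ) (V + Φ)
    rw [add_sub_add_right_eq_sub] at h6
    have h7 : D * (1 + ‖W + Φ‖ ^ (p - 1) + ‖V + Φ‖ ^ (p - 1)) * ‖W - V‖ ≤
        D * (3 * (2 ^ p * (‖Φ‖ ^ p + (1 + K) ^ p))) * ‖W - V‖ := by
      gcongr
      linarith
    linarith [le_abs_self (F (W + Φ) - F (V + Φ))]
  have i0 : IntegrableOn (fun x => F (W + aGrad a φ x)) (cube N) :=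
    integrableOn_cube_of_continuous (hFc.comp (continuous_const.add hc))
  have i1 : IntegrableOn (fun x => F (V + aGrad a φ x)) (cube N) :=
    integrableOn_cube_of_continuous (hFc.comp (continuous_const.add hc))
  have i2 : IntegrableOn (fun x => ‖aGrad a φ x‖ ^ p) (cube N) :=
    integrableOn_cube_of_continuous (hc.norm.rpow_const fun _ => Or.inr hp0.le)
  have i3 : IntegrableOn (fun _ => (1 + K) ^ p) (cube N) :=
    integrableOn_cube_of_continuous continuous_const
  have i4 : IntegrableOn
      (fun x => 3 * D * 2 ^ p * ‖W - V‖ * (‖aGrad a φ x‖ ^ p + (1 + K) ^ p)) (cube N) :=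
    (i2.add i3).const_mul _
  have hmono := integral_mono i0 (i1.add i4) fun x => hpt (aGrad a φ x)
  simp only [Pi.add_apply] at hmono
  rw [integral_add i1 i4, integral_const_mul, integral_add i2 i3, setIntegral_const,
    measureReal_def, volume_cube,
    setIntegral_eq_integral_of_forall_compl_eq_zero (f := fun x => ‖aGrad a φ x‖ ^ p)] at hmono
  · have h2N : ((2 : ℝ≥0∞) ^ N).toReal = 2 ^ N := by simp
    rw [h2N, smul_eq_mul] at hmono
    rw [cubeEnergy_eq, cubeEnergy_eq]
    calc _ ≤ (2 ^ N)⁻¹ * ((∫ x in cube N, F (V + aGrad a φ x)) +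
          3 * D * 2 ^ p * ‖W - V‖ * (B + 2 ^ N * (1 + K) ^ p)) := by
          gcongr
          refine hmono.trans ?_
          gcongr
      _ = _ := by ring
  · intro x hx
    rw [hφ.aGrad_eq_zero a (fun h => hx (hφ.2.2 h)), norm_zero, Real.zero_rpow hp0.ne']

theorem continuous_realEnvelope [NeZero N] {a : Fin N → ℕ+} {p C D : ℝ} (hp : 1 < p) (hD : 0 ≤ D)
    {F : GradSpace n a → ℝ} (hF0 : ∀ X, 0 ≤ F X) (hFc : Continuous F) (hco : LpCoercive a p F)
    (hC : ∀ X, F X ≤ C * (‖X‖ ^ p + 1))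
    (hF : ∀ X W, |F X - F W| ≤ D * (1 + ‖X‖ ^ (p - 1) + ‖W‖ ^ (p - 1)) * ‖X - W‖) :
    Continuous (realEnvelope a F) := by
  refine continuous_iff_continuousAt.2 fun X => ?_
  -- The ball of radius `K` about the origin is then a neighbourhood of `X`.
  set K := ‖X‖ + 1 with hKdef
  have hK : 0 ≤ K := by positivity
  obtain ⟨A, hA⟩ := (isCompact_closedBall (0 : GradSpace n a) K).bddAbove_image hFc.continuousOn
  -- `A` bounds `F`, hence the envelope, on the ball; `1` is the slack of a near-minimiser and `2 ^
  -- N` is the volume of the cube.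
  obtain ⟨B, hB⟩ := hco.exists_bound hp hD hF0 hFc hC hF hK (2 ^ N * (A + 1))
  set L := (2 ^ N)⁻¹ * (3 * D * 2 ^ p * (B + 2 ^ N * (1 + K) ^ p))
  have hlip : LipschitzOnWith (Real.toNNReal L) (realEnvelope a F) (Metric.closedBall 0 K) := by
    refine LipschitzOnWith.of_le_add_mul' L fun W hW V hV => ?_
    rw [dist_eq_norm]
    refine le_of_forall_pos_lt_add fun ε hε => ?_
    have hε' : 0 < min ε 1 := lt_min hε one_pos
    have : Nonempty {φ : EuclideanSpace ℝ (Fin N) → EuclideanSpace ℝ (Fin n) //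
      IsTest (cube N) φ} := ⟨⟨0, isTest_zero _⟩⟩
    -- A near-minimiser at `V` serves as competitor at `W`; the minimum with `1` keeps its energy
    -- under the bound fixed above for every `ε`.
    obtain ⟨⟨φ, hφ⟩, hlt⟩ := exists_lt_of_ciInf_lt
      (show realEnvelope a F V < realEnvelope a F V + min ε 1 by linarith)
    have hAV : F V ≤ A := hA ⟨V, hV, rfl⟩
    have hM : cubeEnergy a F φ V ≤ A + 1 := by
      linarith [realEnvelope_le_self a hF0 V, min_le_right ε 1]
    rw [cubeEnergy_eq, inv_mul_le_iff₀ (by positivity)] at hM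
    rw [mem_closedBall_zero_iff] at hV hW
    have h := cubeEnergy_le_add a hp hD hFc hF hφ (hB V φ hV hφ hM) hV hW
    have h' := realEnvelope_le a hF0 hφ W
    linarith [min_le_left ε 1]
  refine hlip.continuousOn.continuousAt ?_
  refine mem_of_superset (Metric.closedBall_mem_nhds X one_pos)
    (Metric.closedBall_subset_closedBall' ?_)
  rw [dist_zero_right, add_comm]

end MixedSmoothness

end

theorem mainTheorem8 {N n : ℕ} (a : Fin N → ℕ+) (p : ℝ) (hp : 1 < p)
    (F : GradSpace n a → ℝ) (hF_nonneg : ∀ X, 0 ≤ F X) (hF_cont : Continuous F)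
    (hF_coercive : LpCoercive a p F)
    (hF_growth : ∃ C : ℝ, ∀ X, F X ≤ C * (‖X‖ ^ p + 1))
    (hF_lip : ∃ D : ℝ, ∀ X W,
      |F X - F W| ≤ D * (1 + ‖X‖ ^ (p - 1) + ‖W‖ ^ (p - 1)) * ‖X - W‖) :
    ∃ G : GradSpace n a → ℝ, Continuous G ∧ ∀ X, qcEnvelope a F X = (G X : EReal) := by
  obtain ⟨C, hC⟩ := hF_growth
  obtain ⟨D, hD⟩ := hF_lip
  refine ⟨realEnvelope a F, ?_, qcEnvelope_eq_realEnvelope a hF_nonneg⟩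
  -- For `N = 0` the scaling exponent `σ` vanishes, but every weight is then `0`, so there are no
  -- top indices and the matrix space is a point.
  rcases N.eq_zero_or_pos with rfl | hN
  · have : IsEmpty (TopIndex a) := ⟨fun α => by simpa [weight] using α.2⟩
    exact continuous_of_const fun X Y => congrArg _ (Subsingleton.elim X Y)
  · have : NeZero N := ⟨hN.ne'⟩
    -- The given `D` carries no sign, whereas the estimates multiply by it.
    refine continuous_realEnvelope (D := |D|) hp (abs_nonneg D) hF_nonneg hF_cont hF_coercive hC
      fun X W => (hD X W).trans ?_
    gcongr
    exact le_abs_self D
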